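/- Let $d\in\mathbb N_0$, let $A\in\mathbb R^{d\times d}$ be symmetric positive definite, let $c>0$, and let \[ \varphi(x)=c\,\exp\bigl(-\tfrac12\,x^{\top}Ax\bigr),\qquad x\in\mathbb R^d . \] Then $\varphi$ belongs to the Schwartz space $\mathcal S(\mathbb R^d)$ of complex-valued rapidly decreasing smooth functions, and the family $\{x^\alpha\varphi(x):\alpha\in\mathbb N_0^d\}$, where $x^\alpha=x_1^{\alpha_1}\cdots x_d^{\alpha_d}$, is total in $\mathcal S(\mathbb R^d)$, i.e. its complex linear span is dense in $\mathcal S(\mathbb R^d)$. Consequently, for this fixed kernel $\varphi$, the weak moment array \[ {}^{(\varphi)}m_\alpha=\langle T,x^\alpha\varphi\rangle,\qquad \alpha\in\mathbb N_0^d, \] determines the tempered distribution $T\in\mathcal S'(\mathbb R^d)$ uniquely: if $T_1,T_2\in\mathcal S'(\mathbb R^d)$ satisfy $\langle T_1,x^\alpha\varphi\rangle=\langle T_2,x^\alpha\varphi\rangle$ for all $\alpha\in\mathbb N_0^d$, then $T_1=T_2$. -/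

import Mathlib

open scoped SchwartzMap

noncomputable section

namespace WeakMoment

/-- The monomial `x^α = x₁^α₁ ⋯ x_d^α_d` on `ℝ^d` for a multi-index `α ∈ ℕ₀^d`. -/
def monomial {d : ℕ} (α : Fin d → ℕ) (x : EuclideanSpace ℝ (Fin d)) : ℝ :=
  ∏ i, x i ^ α i

theorem monomial_hasTemperateGrowth {d : ℕ} (α : Fin d → ℕ) :
    (fun x : EuclideanSpace ℝ (Fin d) => (monomial α x : ℂ)).HasTemperateGrowth := by
  classical
  have h (s : Finset (Fin d)) : (fun x : EuclideanSpace ℝ (Fin d) =>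
      ((∏ i ∈ s, x i ^ α i : ℝ) : ℂ)).HasTemperateGrowth := by
    induction s using Finset.induction_on with
    | empty => simpa using Function.HasTemperateGrowth.const (1 : ℂ)
    | insert a s ha ih =>
      simp only [Finset.prod_insert ha, Complex.ofReal_mul, Complex.ofReal_pow]
      refine Function.HasTemperateGrowth.fun_mul (Function.HasTemperateGrowth.fun_pow ?_ _) ?_
      · exact (Complex.ofRealCLM ∘L EuclideanSpace.proj (𝕜 := ℝ) a).hasTemperateGrowth
      · simpa using ih
  exact h Finset.univ

/-- The Schwartz function `x ↦ x^α φ(x)`. -/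
def monomialMul {d : ℕ} (α : Fin d → ℕ) (φ : 𝓢(EuclideanSpace ℝ (Fin d), ℂ)) :
    𝓢(EuclideanSpace ℝ (Fin d), ℂ) :=
  SchwartzMap.smulLeftCLM ℂ (fun x => (monomial α x : ℂ)) φ

@[simp]
theorem monomialMul_apply {d : ℕ} (α : Fin d → ℕ) (φ : 𝓢(EuclideanSpace ℝ (Fin d), ℂ))
    (x : EuclideanSpace ℝ (Fin d)) :
    monomialMul α φ x = (∏ i, x i ^ α i : ℝ) * φ x := by
  rw [monomialMul, SchwartzMap.smulLeftCLM_apply_apply (monomial_hasTemperateGrowth α)]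
  rfl

/-- The weak moment array `(⟨T, x^α φ⟩)_α` of a distribution-kernel pair `(T, φ)`. -/
def weakMoment {d : ℕ} (T : 𝓢'(EuclideanSpace ℝ (Fin d), ℂ))
    (φ : 𝓢(EuclideanSpace ℝ (Fin d), ℂ)) (α : Fin d → ℕ) : ℂ :=
  T (monomialMul α φ)

/-- A family in a complex topological vector space is total if its linear span is dense. -/
def IsTotal {ι V : Type*} [AddCommGroup V] [Module ℂ V] [TopologicalSpace V] (v : ι → V) : Prop :=
  Dense (Submodule.span ℂ (Set.range v) : Set V)

/-- The quadratic form `xᵀ A x`. -/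
def quadForm {d : ℕ} (A : Matrix (Fin d) (Fin d) ℝ) (x : EuclideanSpace ℝ (Fin d)) : ℝ :=
  x.ofLp ⬝ᵥ A.mulVec x.ofLp

theorem quadForm_hasTemperateGrowth {d : ℕ} (A : Matrix (Fin d) (Fin d) ℝ) :
    (quadForm A).HasTemperateGrowth := by
  have h : quadForm A = fun x => ∑ i, ∑ j, x i * (A i j * x j) := by
    ext x
    simp [quadForm, dotProduct, Matrix.mulVec, Finset.mul_sum]
  rw [h]
  have hp (i : Fin d) : (fun x : EuclideanSpace ℝ (Fin d) => x i).HasTemperateGrowth :=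
    (EuclideanSpace.proj (𝕜 := ℝ) i).hasTemperateGrowth
  refine Function.HasTemperateGrowth.sum fun i _ => Function.HasTemperateGrowth.sum fun j _ => ?_
  exact (hp i).fun_mul ((Function.HasTemperateGrowth.const _).fun_mul (hp j))

theorem exists_le_quadForm {d : ℕ} {A : Matrix (Fin d) (Fin d) ℝ} (hA : A.PosDef) :
    ∃ m : ℝ, 0 < m ∧ ∀ x, m * ‖x‖ ^ 2 ≤ quadForm A x := by
  have hpos (x : EuclideanSpace ℝ (Fin d)) (hx : x ≠ 0) : 0 < quadForm A x := by
    have := hA.dotProduct_mulVec_pos (x := x.ofLp) (by simpa using hx)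
    simpa [quadForm] using this
  have hcont : Continuous (quadForm A) := (quadForm_hasTemperateGrowth A).1.continuous
  have hsmul (r : ℝ) (x : EuclideanSpace ℝ (Fin d)) :
      quadForm A (r • x) = r ^ 2 * quadForm A x := by
    simp [quadForm, Matrix.mulVec_smul, pow_two, mul_assoc]
  have hz : quadForm A 0 = 0 := by simp [quadForm]
  obtain hs | hs := (Metric.sphere (0 : EuclideanSpace ℝ (Fin d)) 1).eq_empty_or_nonempty
  · refine ⟨1, one_pos, fun x => ?_⟩
    by_cases hx : x = 0
    · simp [hx, hz]
    · have : (‖x‖⁻¹ • x) ∈ Metric.sphere (0 : EuclideanSpace ℝ (Fin d)) 1 := by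
        simp [norm_smul, hx]
      simp [hs] at this
  · obtain ⟨y, hy, hmin⟩ := (isCompact_sphere _ _).exists_isMinOn hs hcont.continuousOn
    have hy1 : ‖y‖ = 1 := by simpa using hy
    refine ⟨quadForm A y, hpos y (by rintro rfl; simp at hy1), fun x => ?_⟩
    by_cases hx : x = 0
    · simp [hx, hz]
    · have hn : 0 < ‖x‖ := norm_pos_iff.2 hx
      have h1 : quadForm A y ≤ quadForm A (‖x‖⁻¹ • x) := hmin (by simp [norm_smul, hx])
      rw [hsmul] at h1
      calc quadForm A y * ‖x‖ ^ 2 ≤ ‖x‖⁻¹ ^ 2 * quadForm A x * ‖x‖ ^ 2 := by gcongr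
        _ = quadForm A x := by field_simp

theorem exists_pow_mul_exp_le (m : ℕ) {b : ℝ} (hb : 0 < b) :
    ∃ C : ℝ, ∀ r : ℝ, 0 ≤ r → (1 + r) ^ m * Real.exp (-(b * r ^ 2)) ≤ C := by
  refine ⟨m.factorial * Real.exp (1 + 1 / (4 * b)), fun r hr => ?_⟩
  have h1 : -(b * r ^ 2) ≤ (1 + 1 / (4 * b)) - (1 + r) := by
    have : 0 ≤ b * (r - 1 / (2 * b)) ^ 2 := by positivity
    have h2 : b * (r - 1 / (2 * b)) ^ 2 = b * r ^ 2 - r + 1 / (4 * b) := by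
      field_simp
      ring
    linarith
  have h2 := Real.pow_div_factorial_le_exp (1 + r) (by linarith) m
  rw [div_le_iff₀ (by positivity)] at h2
  calc (1 + r) ^ m * Real.exp (-(b * r ^ 2))
      ≤ (Real.exp (1 + r) * m.factorial) * Real.exp ((1 + 1 / (4 * b)) - (1 + r)) := by gcongr
    _ = m.factorial * Real.exp (1 + 1 / (4 * b)) := by
      rw [Real.exp_sub]
      field_simp

theorem gaussian_decay {d : ℕ} {A : Matrix (Fin d) (Fin d) ℝ} (hA : A.PosDef) (c : ℝ) (k n : ℕ) :
    ∃ C : ℝ, ∀ x, ‖x‖ ^ k * ‖iteratedFDeriv ℝ n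
      (fun x => ((c * Real.exp (-(1 / 2) * quadForm A x) : ℝ) : ℂ)) x‖ ≤ C := by
  obtain ⟨m, hm, hq⟩ := exists_le_quadForm hA
  have hg : (fun x => -(1 / 2) * quadForm A x).HasTemperateGrowth :=
    (Function.HasTemperateGrowth.const _).fun_mul (quadForm_hasTemperateGrowth A)
  obtain ⟨l, K, hK, hder⟩ := hg.norm_iteratedFDeriv_le_uniform n
  obtain ⟨C, hC⟩ := exists_pow_mul_exp_le (k + l * n) (half_pos hm)
  have he : ContDiff ℝ n (fun t : ℝ => c * Real.exp t) := contDiff_const.mul Real.contDiff_exp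
  have hg' : ContDiff ℝ n (fun x => -(1 / 2) * quadForm A x) :=
    hg.1.of_le (by exact_mod_cast le_top)
  refine ⟨n.factorial * |c| * (1 + K) ^ n * C, fun x => ?_⟩
  have h0 : ‖iteratedFDeriv ℝ n
      (fun x => ((c * Real.exp (-(1 / 2) * quadForm A x) : ℝ) : ℂ)) x‖ =
      ‖iteratedFDeriv ℝ n ((fun t : ℝ => c * Real.exp t) ∘
        (fun x => -(1 / 2) * quadForm A x)) x‖ :=
    Complex.ofRealLI.norm_iteratedFDeriv_comp_left (he.comp hg').contDiffAt le_rfl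
  have h1 : ‖iteratedFDeriv ℝ n ((fun t : ℝ => c * Real.exp t) ∘
        (fun x => -(1 / 2) * quadForm A x)) x‖ ≤
      n.factorial * (|c| * Real.exp (-(1 / 2) * quadForm A x)) *
        ((1 + K) * (1 + ‖x‖) ^ l) ^ n := by
    refine norm_iteratedFDeriv_comp_le he hg' le_rfl x (fun i _ => ?_) fun i hi hin => ?_
    · have : iteratedDeriv i (fun t : ℝ => c * Real.exp t) = fun t => c * Real.exp t := by
        ext t
        rw [iteratedDeriv_const_mul_field, iteratedDeriv_eq_iterate, Real.iter_deriv_exp]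
      rw [norm_iteratedFDeriv_eq_norm_iteratedDeriv, this]
      simp
    · have h2 : 1 ≤ (1 + ‖x‖) ^ l := one_le_pow₀ (by linarith [norm_nonneg x])
      have h3 : 1 ≤ (1 + K) * (1 + ‖x‖) ^ l := one_le_mul_of_one_le_of_one_le (by linarith) h2
      calc _ ≤ K * (1 + ‖x‖) ^ l := hder i hin x
        _ ≤ (1 + K) * (1 + ‖x‖) ^ l := by gcongr; linarith
        _ ≤ _ := le_self_pow₀ h3 (by omega)
  rw [h0]
  have h4 : Real.exp (-(1 / 2) * quadForm A x) ≤ Real.exp (-(m / 2 * ‖x‖ ^ 2)) := by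
    apply Real.exp_le_exp.2
    linarith [hq x]
  calc _ ≤ (1 + ‖x‖) ^ k * (n.factorial * (|c| * Real.exp (-(m / 2 * ‖x‖ ^ 2))) *
        ((1 + K) * (1 + ‖x‖) ^ l) ^ n) := by
        refine mul_le_mul ?_ (h1.trans ?_) (norm_nonneg _) (by positivity)
        · gcongr
          linarith
        · gcongr
    _ = n.factorial * |c| * (1 + K) ^ n *
        ((1 + ‖x‖) ^ (k + l * n) * Real.exp (-(m / 2 * ‖x‖ ^ 2))) := by
        rw [mul_pow, ← pow_mul, pow_add]
        ring
    _ ≤ _ := by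
        gcongr
        exact hC _ (norm_nonneg x)

/-- The Gaussian kernel `φ(x) = c exp(-½ xᵀ A x)` as a Schwartz function on `ℝ^d`, for a symmetric
positive definite matrix `A`. -/
def gaussianKernel {d : ℕ} (A : Matrix (Fin d) (Fin d) ℝ) (hA : A.PosDef) (c : ℝ) :
    𝓢(EuclideanSpace ℝ (Fin d), ℂ) where
  toFun x := ((c * Real.exp (-(1 / 2) * quadForm A x) : ℝ) : ℂ)
  smooth' := Complex.ofRealCLM.contDiff.comp (contDiff_const.mul
    (Real.contDiff_exp.comp (contDiff_const.mul (quadForm_hasTemperateGrowth A).1)))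
  decay' := gaussian_decay hA c

@[simp]
theorem gaussianKernel_apply {d : ℕ} (A : Matrix (Fin d) (Fin d) ℝ) (hA : A.PosDef) (c : ℝ)
    (x : EuclideanSpace ℝ (Fin d)) :
    gaussianKernel A hA c x = ((c * Real.exp (-(1 / 2) * quadForm A x) : ℝ) : ℂ) :=
  rfl

end WeakMoment

end

/-! Let `M` be the closed span of the functions x^α φ. Gaussian decay beats every exp(a‖x‖), so for
each linear form L the exponential series of exp(iL), multiplied by φ, converges in the Schwartz
topology; hence `M` contains every character times φ (`mem_of_eq_exp_mul`).

Characters are then superposed. For ψ Schwartz, ψφ is the Fourier transform of 𝓕⁻ψ ∗ 𝓕⁻φ, a weighted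
integral of translates of 𝓕⁻φ, and these translates transform to characters times φ. A closed
subspace is stable under such integrals, so ψφ lies in `M`
(`convolution_mem_of_compSubConstCLM_mem`, `mul_mem_of_exp_mul_mem`).

Since φ has no zeros, a compactly supported f equals (f/φ)φ with f/φ a test function, so f lies in
`M`; such f are dense (`eq_top_of_hasCompactSupport_mem`). Uniqueness of T follows because
continuous functionals agreeing on a total family coincide. -/

namespace WeakMoment

open scoped FourierTransform LineDeriv BoundedContinuousFunction
open SchwartzMap MeasureTheory

/-! ### Translates of Schwartz functions, and Schwartz seminorms as Banach norms -/

section Translates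

variable {V : Type*} [NormedAddCommGroup V] [NormedSpace ℝ V]

theorem iteratedFDeriv_compSubConstCLM (n : ℕ) (f : 𝓢(V, ℂ)) (y x : V) :
    iteratedFDeriv ℝ n (f.compSubConstCLM ℂ y) x = iteratedFDeriv ℝ n f (x - y) :=
  iteratedFDeriv_comp_sub n y x

theorem norm_pow_mul_iteratedFDeriv_sub_le (k n : ℕ) (f : 𝓢(V, ℂ)) (x y : V) :
    ‖x‖ ^ k * ‖iteratedFDeriv ℝ n f (x - y)‖ ≤
      2 ^ k * (SchwartzMap.seminorm ℂ k n f + ‖y‖ ^ k * SchwartzMap.seminorm ℂ 0 n f) := by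
  have h1 : ‖x‖ ^ k ≤ 2 ^ k * (‖x - y‖ ^ k + ‖y‖ ^ k) := by
    calc ‖x‖ ^ k ≤ (‖x - y‖ + ‖y‖) ^ k := by
          gcongr
          simpa using norm_add_le (x - y) y
      _ ≤ 2 ^ (k - 1) * (‖x - y‖ ^ k + ‖y‖ ^ k) :=
          add_pow_le (norm_nonneg _) (norm_nonneg _) k
      _ ≤ _ := by
          gcongr
          · norm_num
          · omega
  calc _ ≤ 2 ^ k * (‖x - y‖ ^ k + ‖y‖ ^ k) * ‖iteratedFDeriv ℝ n f (x - y)‖ := by gcongr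
    _ = 2 ^ k * (‖x - y‖ ^ k * ‖iteratedFDeriv ℝ n f (x - y)‖ +
        ‖y‖ ^ k * ‖iteratedFDeriv ℝ n f (x - y)‖) := by ring
    _ ≤ _ := by
        gcongr
        · exact le_seminorm ℂ k n f _
        · exact norm_iteratedFDeriv_le_seminorm ℂ f n _

theorem seminorm_compSubConstCLM_le (k n : ℕ) (f : 𝓢(V, ℂ)) (y : V) :
    SchwartzMap.seminorm ℂ k n (f.compSubConstCLM ℂ y) ≤
      2 ^ k * (SchwartzMap.seminorm ℂ k n f + ‖y‖ ^ k * SchwartzMap.seminorm ℂ 0 n f) := by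
  refine seminorm_le_bound ℂ k n _ (by positivity) fun x => ?_
  rw [iteratedFDeriv_compSubConstCLM]
  exact norm_pow_mul_iteratedFDeriv_sub_le k n f x y

/-- Mean value inequality in the translation parameter on the unit ball about `y₀`: up to sign,
differentiating Dⁿf(x - z) in z gives Dⁿ⁺¹f(x - z), whence the seminorms of order `n + 1`. -/
theorem seminorm_compSubConstCLM_sub_le (k n : ℕ) (f : 𝓢(V, ℂ)) {y y₀ : V}
    (hy : ‖y - y₀‖ ≤ 1) :
    SchwartzMap.seminorm ℂ k n (f.compSubConstCLM ℂ y - f.compSubConstCLM ℂ y₀) ≤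
      2 ^ k * (SchwartzMap.seminorm ℂ k (n + 1) f +
        (‖y₀‖ + 1) ^ k * SchwartzMap.seminorm ℂ 0 (n + 1) f) * ‖y - y₀‖ := by
  refine seminorm_le_bound ℂ k n _ (by positivity) fun x => ?_
  have h0 : iteratedFDeriv ℝ n ⇑(f.compSubConstCLM ℂ y - f.compSubConstCLM ℂ y₀) x =
      iteratedFDeriv ℝ n f (x - y) - iteratedFDeriv ℝ n f (x - y₀) := by
    rw [← iteratedFDeriv_compSubConstCLM, ← iteratedFDeriv_compSubConstCLM]
    exact iteratedFDeriv_sub_apply (SchwartzMap.contDiffAt _ _) (SchwartzMap.contDiffAt _ _)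
  have hd : Differentiable ℝ (iteratedFDeriv ℝ n f) :=
    (f.smooth ⊤).differentiable_iteratedFDeriv (mod_cast ENat.natCast_lt_top n)
  have hd' (z : V) : DifferentiableAt ℝ (fun z => iteratedFDeriv ℝ n f (x - z)) z :=
    (hd (x - z)).comp z (differentiableAt_id.const_sub x)
  rw [h0]
  -- The case ‖x‖ ^ k = 0 is split off because the derivative bound below divides by this weight.
  obtain hx | hx := (pow_nonneg (norm_nonneg x) k).eq_or_lt
  · rw [← hx, zero_mul]
    positivity
  have h1 (z : V) (hz : z ∈ Metric.closedBall y₀ 1) :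
      ‖fderiv ℝ (fun z => iteratedFDeriv ℝ n f (x - z)) z‖ ≤
        2 ^ k * (SchwartzMap.seminorm ℂ k (n + 1) f +
        (‖y₀‖ + 1) ^ k * SchwartzMap.seminorm ℂ 0 (n + 1) f) / ‖x‖ ^ k := by
    have hz' : fderiv ℝ (fun z => iteratedFDeriv ℝ n f (x - z)) z =
        -fderiv ℝ (iteratedFDeriv ℝ n f) (x - z) := by
      have := ((hd (x - z)).hasFDerivAt.comp z ((hasFDerivAt_id z).const_sub x)).fderiv
      simpa [Function.comp_def] using this
    have hn : ‖fderiv ℝ (fun z => iteratedFDeriv ℝ n f (x - z)) z‖ =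
        ‖iteratedFDeriv ℝ (n + 1) f (x - z)‖ := by
      rw [hz', ← norm_fderiv_iteratedFDeriv]
      exact norm_neg (fderiv ℝ (iteratedFDeriv ℝ n f) (x - z))
    rw [hn, le_div_iff₀' hx]
    refine (norm_pow_mul_iteratedFDeriv_sub_le k (n + 1) f x z).trans ?_
    gcongr
    rw [mem_closedBall_iff_norm] at hz
    linarith [norm_le_norm_add_norm_sub' z y₀]
  have h2 := (convex_closedBall y₀ 1).norm_image_sub_le_of_norm_fderiv_le
    (𝕜 := ℝ) (fun z _ => hd' z) h1 (Metric.mem_closedBall_self zero_le_one)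
    (mem_closedBall_iff_norm.2 hy)
  rwa [div_mul_eq_mul_div, le_div_iff₀' hx] at h2

/-- Supplies the measurability of the vector-valued integrands in the convolution section. -/
theorem continuous_compSubConstCLM (f : 𝓢(V, ℂ)) :
    Continuous fun y : V => f.compSubConstCLM ℂ y := by
  refine continuous_iff_continuousAt.2 fun y₀ => ?_
  refine ((schwartz_withSeminorms ℂ V ℂ).tendsto_nhds _ _).2 fun ⟨k, n⟩ ε hε => ?_
  have h : Filter.Tendsto (fun y : V => 2 ^ k * (SchwartzMap.seminorm ℂ k (n + 1) f +
      (‖y₀‖ + 1) ^ k * SchwartzMap.seminorm ℂ 0 (n + 1) f) * ‖y - y₀‖) (nhds y₀) (nhds 0) := by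
    have : Continuous (fun y : V => 2 ^ k * (SchwartzMap.seminorm ℂ k (n + 1) f +
      (‖y₀‖ + 1) ^ k * SchwartzMap.seminorm ℂ 0 (n + 1) f) * ‖y - y₀‖) := by fun_prop
    simpa using this.tendsto y₀
  filter_upwards [h.eventually (gt_mem_nhds hε), Metric.closedBall_mem_nhds y₀ one_pos] with y h1 h2
  exact (seminorm_compSubConstCLM_sub_le k n f (mem_closedBall_iff_norm.1 h2)).trans_lt h1

/-- The space of continuous `n`-linear forms `Vⁿ → ℂ`, in which `n`-th derivatives live, as a type
of its own. -/
def DerivSpace (V : Type*) [NormedAddCommGroup V] [NormedSpace ℝ V] (n : ℕ) : Type _ :=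
  V [×n]→L[ℝ] ℂ

noncomputable instance (n : ℕ) : NormedAddCommGroup (DerivSpace V n) :=
  inferInstanceAs (NormedAddCommGroup (V [×n]→L[ℝ] ℂ))

noncomputable instance (n : ℕ) : NormedSpace ℂ (DerivSpace V n) :=
  inferInstanceAs (NormedSpace ℂ (V [×n]→L[ℝ] ℂ))

instance (n : ℕ) : CompleteSpace (DerivSpace V n) :=
  inferInstanceAs (CompleteSpace (V [×n]→L[ℝ] ℂ))

/-- Evaluation of a multilinear form at `m`. -/
noncomputable def DerivSpace.eval {n : ℕ} (m : Fin n → V) : DerivSpace V n →L[ℂ] ℂ :=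
  LinearMap.mkContinuous
    { toFun := fun A => (show V [×n]→L[ℝ] ℂ from A) m
      map_add' := fun _ _ => rfl
      map_smul' := fun _ _ => rfl }
    (∏ i, ‖m i‖) fun A => (ContinuousMultilinearMap.le_opNorm (show V [×n]→L[ℝ] ℂ from A) m).trans_eq
      (mul_comm _ _)

theorem DerivSpace.ext {n : ℕ} {A B : DerivSpace V n} (h : ∀ m, eval m A = eval m B) : A = B :=
  ContinuousMultilinearMap.ext h

/-- The `n`-th derivative of a Schwartz function. -/
noncomputable def schwartzDeriv (n : ℕ) (f : 𝓢(V, ℂ)) (x : V) : DerivSpace V n :=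
  iteratedFDeriv ℝ n f x

theorem norm_schwartzDeriv (n : ℕ) (f : 𝓢(V, ℂ)) (x : V) :
    ‖schwartzDeriv n f x‖ = ‖iteratedFDeriv ℝ n f x‖ :=
  rfl

theorem eval_schwartzDeriv (n : ℕ) (f : 𝓢(V, ℂ)) (x : V) (m : Fin n → V) :
    DerivSpace.eval m (schwartzDeriv n f x) = (∂^{m} f : 𝓢(V, ℂ)) x :=
  iteratedLineDerivOp_eq_iteratedFDeriv.symm

theorem continuous_schwartzDeriv (n : ℕ) (f : 𝓢(V, ℂ)) : Continuous (schwartzDeriv n f) :=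
  (f.smooth ⊤).continuous_iteratedFDeriv (mod_cast le_top)

/-- The weighted derivative `x ↦ ‖x‖ ^ k • Dⁿ f x` as a bounded continuous function. -/
noncomputable def weightedDeriv (i : ℕ × ℕ) : 𝓢(V, ℂ) →L[ℂ] V →ᵇ DerivSpace V i.2 :=
  mkCLMtoNormedSpace (fun f : 𝓢(V, ℂ) => BoundedContinuousFunction.ofNormedAddCommGroup
      (fun x => ((‖x‖ ^ i.1 : ℝ) : ℂ) • schwartzDeriv i.2 f x)
      ((Complex.continuous_ofReal.comp (continuous_norm.pow _)).smul
        (continuous_schwartzDeriv i.2 f))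
      (SchwartzMap.seminorm ℂ i.1 i.2 f) fun x => by
        simpa [norm_smul, norm_schwartzDeriv] using le_seminorm ℂ i.1 i.2 f x)
    (fun f g => by
      ext1 x
      refine DerivSpace.ext fun m => ?_
      simp [eval_schwartzDeriv, LineDeriv.iteratedLineDerivOp_add, mul_add])
    (fun a f => by
      ext1 x
      refine DerivSpace.ext fun m => ?_
      simp [eval_schwartzDeriv, LineDeriv.iteratedLineDerivOp_smul, mul_left_comm])
    ⟨{i}, 1, zero_le_one, fun f => by
      rw [Finset.sup_singleton, one_mul]
      exact BoundedContinuousFunction.norm_ofNormedAddCommGroup_le _ (apply_nonneg _ _) _⟩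

theorem weightedDeriv_apply (i : ℕ × ℕ) (f : 𝓢(V, ℂ)) (x : V) :
    weightedDeriv i f x = ((‖x‖ ^ i.1 : ℝ) : ℂ) • schwartzDeriv i.2 f x :=
  rfl

/-- Each Schwartz seminorm is thus the pullback of the norm of a Banach space, where Bochner
integrals make sense. -/
theorem norm_weightedDeriv (i : ℕ × ℕ) (f : 𝓢(V, ℂ)) :
    ‖weightedDeriv i f‖ = SchwartzMap.seminorm ℂ i.1 i.2 f := by
  refine le_antisymm (((weightedDeriv i f).norm_le (apply_nonneg _ _)).2 fun x => ?_)
    (seminorm_le_bound ℂ _ _ _ (norm_nonneg _) fun x => ?_)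
  · simpa [weightedDeriv_apply, norm_smul, norm_schwartzDeriv] using le_seminorm ℂ i.1 i.2 f x
  · simpa [weightedDeriv_apply, norm_smul, norm_schwartzDeriv] using
      (weightedDeriv i f).norm_coe_le_norm x

/-- A basic Schwartz neighbourhood involves only finitely many seminorms, so approximation in finite
products of Banach spaces suffices. -/
theorem mem_closure_of_forall_pi_weightedDeriv {S : Set 𝓢(V, ℂ)} {f : 𝓢(V, ℂ)}
    (h : ∀ s : Finset (ℕ × ℕ), ContinuousLinearMap.pi (fun i : s => weightedDeriv (V := V) i) f ∈
      closure (ContinuousLinearMap.pi (fun i : s => weightedDeriv (V := V) i) '' S)) :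
    f ∈ closure S := by
  refine (mem_closure_iff_nhds_basis (schwartz_withSeminorms ℂ V ℂ).hasBasis_ball).2 ?_
  rintro ⟨s, ε⟩ hε
  obtain ⟨_, ⟨g, hg, rfl⟩, hd⟩ := Metric.mem_closure_iff.1 (h s) ε hε
  refine ⟨g, hg, ?_⟩
  rw [Seminorm.mem_ball]
  refine Seminorm.finset_sup_apply_lt hε fun i hi => ?_
  have h1 := (dist_le_pi_dist _ _ (⟨i, hi⟩ : s)).trans_lt hd
  have h2 : dist (weightedDeriv i f) (weightedDeriv i g) < ε := h1
  rwa [dist_comm, dist_eq_norm, ← map_sub, norm_weightedDeriv] at h2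

end Translates

/-- The quotient map by `K` is continuous and linear, so it commutes with the integral, and it kills
every value of `F`. -/
theorem integral_mem_of_isClosed {X B : Type*} [MeasurableSpace X] {μ : Measure X}
    [NormedAddCommGroup B] [NormedSpace ℂ B] [CompleteSpace B] (K : Submodule ℂ B)
    (hK : IsClosed (K : Set B)) {F : X → B} (hF : Integrable F μ) (h : ∀ x, F x ∈ K) :
    ∫ x, F x ∂μ ∈ K := by
  have : IsClosed (K : Set B) := hK
  rw [← Submodule.Quotient.mk_eq_zero]
  have h1 := K.mkQL.integral_comp_comm hF
  have h2 (x : X) : K.mkQL (F x) = 0 := by simpa using h x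
  simp only [h2, integral_zero] at h1
  exact h1.symm

/-! ### Convolution as an integral of translates -/

section Convolution

variable {V : Type*} [NormedAddCommGroup V] [InnerProductSpace ℝ V] [FiniteDimensional ℝ V]
  [MeasurableSpace V] [BorelSpace V]

/-- On the Fourier side, convolution is a product and the derivative is multiplication by a scalar
function, which can be attached to the second factor. -/
theorem lineDerivOp_convolution (w γ : 𝓢(V, ℂ)) (m : V) :
    ∂_{m} (convolution (ContinuousLinearMap.mul ℂ ℂ) w γ) =
      convolution (ContinuousLinearMap.mul ℂ ℂ) w (∂_{m} γ) := by
  have hm : (inner ℝ · m : V → ℝ).HasTemperateGrowth := by fun_prop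
  have h (f g : 𝓢(V, ℂ)) : convolution (ContinuousLinearMap.mul ℂ ℂ) f g =
      𝓕⁻ (pairing (ContinuousLinearMap.mul ℂ ℂ) (𝓕 f) (𝓕 g)) := rfl
  rw [h, h, lineDerivOp_fourierInv_eq, fourier_lineDerivOp_eq]
  congr 1
  ext x
  simp [hm]
  ring

theorem iteratedLineDerivOp_convolution {n : ℕ} (w γ : 𝓢(V, ℂ)) (m : Fin n → V) :
    ∂^{m} (convolution (ContinuousLinearMap.mul ℂ ℂ) w γ) =
      convolution (ContinuousLinearMap.mul ℂ ℂ) w (∂^{m} γ) := by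
  induction n with
  | zero => simp
  | succ n ih => simp [LineDeriv.iteratedLineDerivOp_succ_left, ih, lineDerivOp_convolution]

theorem integrable_smul_weightedDeriv_compSubConstCLM (w γ : 𝓢(V, ℂ)) (i : ℕ × ℕ) :
    Integrable fun y => w y • weightedDeriv i (γ.compSubConstCLM ℂ y) := by
  refine Integrable.mono' (g := fun y => 2 ^ i.1 * SchwartzMap.seminorm ℂ i.1 i.2 γ * ‖w y‖ +
    2 ^ i.1 * SchwartzMap.seminorm ℂ 0 i.2 γ * (‖y‖ ^ i.1 * ‖w y‖))
    ((w.integrable.norm.const_mul _).add ((w.integrable_pow_mul volume _).const_mul _))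
    (w.continuous.smul ((weightedDeriv i).continuous.comp
      (continuous_compSubConstCLM γ))).aestronglyMeasurable
    (Filter.Eventually.of_forall fun y => ?_)
  rw [norm_smul, norm_weightedDeriv]
  refine (mul_le_mul_of_nonneg_left
    (seminorm_compSubConstCLM_le i.1 i.2 γ y) (norm_nonneg _)).trans_eq ?_
  ring

/-- Evaluation at a point and at a tuple of directions is continuous and linear, so it passes under
the integral; what remains is the convolution formula for ∂^m γ. -/
theorem weightedDeriv_convolution (w γ : 𝓢(V, ℂ)) (i : ℕ × ℕ) :
    weightedDeriv i (convolution (ContinuousLinearMap.mul ℂ ℂ) w γ) =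
      ∫ y, w y • weightedDeriv i (γ.compSubConstCLM ℂ y) := by
  ext1 x
  refine DerivSpace.ext fun m => ?_
  have h := ((DerivSpace.eval m).comp (BoundedContinuousFunction.evalCLM ℂ x)).integral_comp_comm
    (integrable_smul_weightedDeriv_compSubConstCLM w γ i)
  refine Eq.trans ?_ h
  simp only [ContinuousLinearMap.comp_apply, BoundedContinuousFunction.evalCLM_apply,
    weightedDeriv_apply, map_smul, eval_schwartzDeriv,
    iteratedLineDerivOp_convolution, convolution_apply, smul_comm (w _), integral_smul]
  congr 1
  refine integral_congr_ae (Filter.Eventually.of_forall fun y => ?_)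
  change w y * (∂^{m} γ : 𝓢(V, ℂ)) (x - y) = w y * (∂^{m} (γ.compSubConstCLM ℂ y) : 𝓢(V, ℂ)) x
  rw [iteratedLineDerivOp_eq_iteratedFDeriv, iteratedLineDerivOp_eq_iteratedFDeriv,
    iteratedFDeriv_compSubConstCLM]

/-- The integral is taken not in Schwartz space but after the map `J` attached to finitely many
seminorms: there it lies in the closure of the image of `M`. -/
theorem convolution_mem_of_compSubConstCLM_mem {M : Submodule ℂ 𝓢(V, ℂ)}
    (hM : IsClosed (M : Set 𝓢(V, ℂ))) {γ : 𝓢(V, ℂ)} (h : ∀ y, γ.compSubConstCLM ℂ y ∈ M)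
    (w : 𝓢(V, ℂ)) : convolution (ContinuousLinearMap.mul ℂ ℂ) w γ ∈ M := by
  rw [← SetLike.mem_coe, ← hM.closure_eq]
  refine mem_closure_of_forall_pi_weightedDeriv fun s => ?_
  set J := ContinuousLinearMap.pi (fun i : s => weightedDeriv (V := V) i)
  have hint : Integrable fun y => w y • J (γ.compSubConstCLM ℂ y) :=
    Integrable.of_eval fun i => integrable_smul_weightedDeriv_compSubConstCLM w γ i
  have h1 : J (convolution (ContinuousLinearMap.mul ℂ ℂ) w γ) =
      ∫ y, w y • J (γ.compSubConstCLM ℂ y) := by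
    ext1 i
    exact (weightedDeriv_convolution w γ i).trans
      (eval_integral (fun i : s => integrable_smul_weightedDeriv_compSubConstCLM w γ i) i).symm
  rw [h1]
  refine integral_mem_of_isClosed (M.map (J : 𝓢(V, ℂ) →ₗ[ℂ] _)).topologicalClosure
    (Submodule.isClosed_topologicalClosure _) hint fun y => ?_
  refine Submodule.smul_mem _ _ (Submodule.le_topologicalClosure _ ?_)
  exact Submodule.mem_map_of_mem (h y)

end Convolution

end WeakMoment

namespace WeakMoment

open scoped FourierTransform ContDiff
open SchwartzMap MeasureTheory

/-! ### Leibniz estimates for small multipliers -/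

section Multipliers

variable {V : Type*} [NormedAddCommGroup V] [NormedSpace ℝ V]

theorem exists_uniform_bound {X : Type*} {P : ℕ → X → ℝ} (h : ∀ j, ∃ C, ∀ x, P j x ≤ C) (n : ℕ) :
    ∃ C, 0 ≤ C ∧ ∀ j ≤ n, ∀ x, P j x ≤ C := by
  choose C hC using h
  refine ⟨∑ j ∈ Finset.range (n + 1), |C j|, Finset.sum_nonneg fun _ _ => abs_nonneg _,
    fun j hj x => (hC j x).trans ((le_abs_self _).trans ?_)⟩
  exact Finset.single_le_sum (f := fun j => |C j|) (fun _ _ => abs_nonneg _)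
    (Finset.mem_range.2 (by omega))

/-- Leibniz rule with `u` small only relative to a growing weight `W`, which the decay of `f`
absorbs. It is used with `W` = ‖x‖ for cutoffs and `W` = exp(2‖L‖‖x‖) for exponential remainders. -/
theorem norm_pow_mul_iteratedFDeriv_mul_le {u f : V → ℂ} {n : ℕ} (hu : ContDiff ℝ n u)
    (hf : ContDiff ℝ n f) {k : ℕ} {δ W C : ℝ} {x : V} (hδ : 0 ≤ δ)
    (h1 : ∀ i ≤ n, ‖iteratedFDeriv ℝ i u x‖ ≤ δ * W)
    (h2 : ∀ j ≤ n, W * (‖x‖ ^ k * ‖iteratedFDeriv ℝ j f x‖) ≤ C) :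
    ‖x‖ ^ k * ‖iteratedFDeriv ℝ n (fun x => u x * f x) x‖ ≤ δ * (2 ^ n * C) := by
  calc _ ≤ ‖x‖ ^ k * ∑ i ∈ Finset.range (n + 1), (n.choose i : ℝ) * ‖iteratedFDeriv ℝ i u x‖ *
        ‖iteratedFDeriv ℝ (n - i) f x‖ := by
        gcongr
        exact norm_iteratedFDeriv_mul_le hu hf x le_rfl
    _ ≤ ∑ i ∈ Finset.range (n + 1), (n.choose i : ℝ) * (δ * C) := by
        rw [Finset.mul_sum]
        refine Finset.sum_le_sum fun i hi => ?_
        have hi' : i ≤ n := by simpa [Nat.lt_succ_iff] using hi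
        calc _ ≤ ‖x‖ ^ k * ((n.choose i : ℝ) * (δ * W) * ‖iteratedFDeriv ℝ (n - i) f x‖) := by
              gcongr
              exact h1 i hi'
          _ = (n.choose i : ℝ) * (δ * (W * (‖x‖ ^ k * ‖iteratedFDeriv ℝ (n - i) f x‖))) := by ring
          _ ≤ _ := by
              gcongr
              exact h2 _ (Nat.sub_le _ _)
    _ = _ := by
        rw [← Finset.sum_mul, ← Nat.cast_sum, Nat.sum_range_choose]
        push_cast
        ring

end Multipliers

/-! ### Density of compactly supported functions -/

section Cutoff

variable {V : Type*} [NormedAddCommGroup V] [InnerProductSpace ℝ V] [FiniteDimensional ℝ V]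

/-- A smooth compactly supported function which is `1` on the unit ball. -/
noncomputable def cutoff (V : Type*) [NormedAddCommGroup V] [InnerProductSpace ℝ V]
    [FiniteDimensional ℝ V] (x : V) : ℂ :=
  ((⟨1, 2, one_pos, one_lt_two⟩ : ContDiffBump (0 : V)) x : ℝ)

theorem contDiff_cutoff : ContDiff ℝ ∞ (cutoff V) :=
  Complex.ofRealCLM.contDiff.comp (ContDiffBump.contDiff _)

theorem hasCompactSupport_cutoff : HasCompactSupport (cutoff V) :=
  (ContDiffBump.hasCompactSupport _).comp_left Complex.ofReal_zero

theorem cutoff_eq_one {x : V} (hx : ‖x‖ ≤ 1) : cutoff V x = 1 := by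
  have := ContDiffBump.one_of_mem_closedBall (⟨1, 2, one_pos, one_lt_two⟩ : ContDiffBump (0 : V))
    (mem_closedBall_zero_iff.2 hx)
  simp [cutoff, this]

/-- Uniform bounds improve to linear ones because the function vanishes on the unit ball. Under
dilation by 1/(N + 1), the factor ‖x‖ produces the decay in N. -/
theorem exists_norm_iteratedFDeriv_one_sub_cutoff_le (n : ℕ) :
    ∃ C, 0 ≤ C ∧ ∀ i ≤ n, ∀ x : V,
      ‖iteratedFDeriv ℝ i (fun x => 1 - cutoff V x) x‖ ≤ C * ‖x‖ := by
  have h (i : ℕ) : ∃ C, ∀ x : V, ‖iteratedFDeriv ℝ i (fun x => 1 - cutoff V x) x‖ ≤ C := by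
    obtain ⟨C, hC⟩ := (hasCompactSupport_cutoff.toSchwartzMap (contDiff_cutoff (V := V))).decay 0 i
    refine ⟨1 + C, fun x => ?_⟩
    have h1 : iteratedFDeriv ℝ i (fun x => 1 - cutoff V x) x =
        iteratedFDeriv ℝ i (fun _ => (1 : ℂ)) x - iteratedFDeriv ℝ i (cutoff V) x :=
      iteratedFDeriv_sub_apply contDiffAt_const
        (contDiff_cutoff.contDiffAt.of_le (mod_cast le_top))
    have h2 : ‖iteratedFDeriv ℝ i (fun _ : V => (1 : ℂ)) x‖ ≤ 1 := by
      rcases i with _ | i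
      · simp
      · simp [iteratedFDeriv_const_of_ne (Nat.succ_ne_zero i)]
    rw [h1]
    refine (norm_sub_le _ _).trans (add_le_add h2 ?_)
    have h3 := hC.2 x
    rwa [pow_zero, one_mul] at h3
  obtain ⟨C, hC0, hC⟩ := exists_uniform_bound h n
  refine ⟨C, hC0, fun i hi x => ?_⟩
  obtain hx | hx := lt_or_ge ‖x‖ 1
  · have : (fun x => 1 - cutoff V x) =ᶠ[nhds x] fun _ => 0 := by
      filter_upwards [Metric.isOpen_ball.mem_nhds (mem_ball_zero_iff.2 hx)] with y hy
      rw [cutoff_eq_one (mem_ball_zero_iff.1 hy).le, sub_self]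
    rw [(this.iteratedFDeriv ℝ i).eq_of_nhds]
    simp only [iteratedFDeriv_fun_zero, Pi.zero_apply, norm_zero]
    positivity
  · exact (hC i hi x).trans (le_mul_of_one_le_right hC0 hx)

theorem eq_top_of_hasCompactSupport_mem {M : Submodule ℂ 𝓢(V, ℂ)}
    (hM : IsClosed (M : Set 𝓢(V, ℂ))) (h : ∀ f : 𝓢(V, ℂ), HasCompactSupport f → f ∈ M) :
    M = ⊤ := by
  refine eq_top_iff.2 fun f _ => ?_
  have hsm (N : ℕ) : ContDiff ℝ ∞ fun x : V => cutoff V ((N + 1 : ℝ)⁻¹ • x) * f x :=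
    (contDiff_cutoff.comp (contDiff_const_smul _)).mul (f.smooth ⊤)
  have hcs (N : ℕ) : HasCompactSupport fun x : V => cutoff V ((N + 1 : ℝ)⁻¹ • x) * f x :=
    (hasCompactSupport_cutoff.comp_smul (by positivity)).mul_right
  refine hM.mem_of_tendsto (b := Filter.atTop) (f := fun N : ℕ => (hcs N).toSchwartzMap (hsm N))
    (((schwartz_withSeminorms ℂ V ℂ).tendsto_nhds _ _).2 fun ⟨k, n⟩ ε hε => ?_)
    (Filter.Eventually.of_forall fun N => h _ (hcs N))
  obtain ⟨C₁, hC₁, hC⟩ := exists_norm_iteratedFDeriv_one_sub_cutoff_le (V := V) n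
  -- The extra factor ‖x‖ from the cutoff bound is paid for by the seminorms of weight `k + 1`.
  obtain ⟨C₂, hC₂, hD⟩ := exists_uniform_bound
    (P := fun j x => ‖x‖ * (‖x‖ ^ k * ‖iteratedFDeriv ℝ j f x‖))
    (fun j => ⟨SchwartzMap.seminorm ℂ (k + 1) j f, fun x => by
      simpa [pow_succ', mul_assoc] using le_seminorm ℂ (k + 1) j f x⟩) n
  have hb (N : ℕ) : SchwartzMap.seminorm ℂ k n ((hcs N).toSchwartzMap (hsm N) - f) ≤
      (1 / ((N : ℝ) + 1)) * (C₁ * (2 ^ n * C₂)) := by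
    rw [map_sub_rev]
    refine seminorm_le_bound ℂ k n _ (by positivity) fun x => ?_
    have he : ⇑(f - (hcs N).toSchwartzMap (hsm N)) =
        fun x => (1 - cutoff V ((N + 1 : ℝ)⁻¹ • x)) * f x := by
      ext x
      simp [sub_mul]
    have hg : ContDiff ℝ ∞ fun x => 1 - cutoff V x := contDiff_const.sub contDiff_cutoff
    rw [he, ← mul_assoc]
    refine norm_pow_mul_iteratedFDeriv_mul_le (u := fun x => 1 - cutoff V ((N + 1 : ℝ)⁻¹ • x))
      ((hg.comp (contDiff_const_smul _)).of_le (mod_cast le_top)) (f.smooth n) (by positivity)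
      (fun i hi => ?_) fun j hj => hD j hj x
    rw [iteratedFDeriv_comp_const_smul (f := fun x => 1 - cutoff V x) _
      (hg.of_le (mod_cast le_top))]
    have hN : (0 : ℝ) ≤ ((N : ℝ) + 1)⁻¹ := by positivity
    have hN' : ((N : ℝ) + 1)⁻¹ ≤ 1 := inv_le_one_of_one_le₀ (by linarith [N.cast_nonneg (α := ℝ)])
    calc _ ≤ ((N : ℝ) + 1)⁻¹ ^ i *
          ‖iteratedFDeriv ℝ i (fun x => 1 - cutoff V x) ((N + 1 : ℝ)⁻¹ • x)‖ := by
          refine (norm_smul_le (((N : ℝ) + 1)⁻¹ ^ i)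
            (iteratedFDeriv ℝ i (fun x => 1 - cutoff V x) ((N + 1 : ℝ)⁻¹ • x))).trans_eq ?_
          rw [Real.norm_of_nonneg (by positivity)]
      _ ≤ 1 * (C₁ * ‖(N + 1 : ℝ)⁻¹ • x‖) := by
          gcongr
          · exact pow_le_one₀ hN hN'
          · exact hC i hi _
      _ = _ := by
          rw [norm_smul, Real.norm_of_nonneg hN]
          ring
  have ht : Filter.Tendsto (fun N : ℕ => (1 / ((N : ℝ) + 1)) * (C₁ * (2 ^ n * C₂)))
      Filter.atTop (nhds 0) := by
    simpa using tendsto_one_div_add_atTop_nhds_zero_nat.mul_const (C₁ * (2 ^ n * C₂))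
  filter_upwards [ht.eventually (gt_mem_nhds hε)] with N hN
  exact (hb N).trans_lt hN

end Cutoff

end WeakMoment

namespace WeakMoment

open scoped FourierTransform ContDiff
open SchwartzMap MeasureTheory

/-! ### Convergence of the exponential series against rapid decay -/

section Exponential

/-- The remainder of the exponential series. -/
noncomputable def expTail (N : ℕ) (z : ℂ) : ℂ :=
  Complex.exp z - ∑ m ∈ Finset.range N, z ^ m / m.factorial

/-- Truncated subtraction is right at `N = 0`: the remainder is then exp, its own derivative. -/
theorem hasDerivAt_expTail (N : ℕ) (z : ℂ) : HasDerivAt (expTail N) (expTail (N - 1) z) z := by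
  have h (m : ℕ) : HasDerivAt (fun z : ℂ => z ^ m / m.factorial)
      (m * z ^ (m - 1) / m.factorial) z := (hasDerivAt_pow m z).div_const _
  have h1 := (Complex.hasDerivAt_exp z).sub (HasDerivAt.fun_sum fun m (_ : m ∈ Finset.range N) => h m)
  refine h1.congr_deriv ?_
  rw [expTail]
  congr 1
  rcases N with _ | N
  · simp
  · rw [Finset.sum_range_succ']
    simp only [Nat.cast_zero, zero_mul, zero_div, add_zero, Nat.add_sub_cancel]
    refine Finset.sum_congr rfl fun m _ => ?_
    rw [Nat.factorial_succ]
    push_cast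
    field_simp

/-- For m ≥ N, r^m/m! ≤ 2^(-N) (2r)^m/m!: doubling the exponent buys geometric decay in `N`. -/
theorem norm_expTail_le (N : ℕ) (z : ℂ) : ‖expTail N z‖ ≤ (1 / 2) ^ N * Real.exp (2 * ‖z‖) := by
  refine (Complex.norm_exp_sub_sum_le_exp_norm_sub_sum z N).trans ?_
  have hs (r : ℝ) : HasSum (fun m : ℕ => r ^ m / m.factorial) (Real.exp r) := by
    rw [Real.exp_eq_exp_ℝ]
    exact NormedSpace.expSeries_div_hasSum_exp r
  have h1 := (hasSum_nat_add_iff' N).2 (hs ‖z‖)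
  have h2 := ((hasSum_nat_add_iff' N).2 (hs (2 * ‖z‖))).mul_left ((1 / 2 : ℝ) ^ N)
  refine (hasSum_le (fun m => ?_) h1 h2).trans ?_
  · have : (1 : ℝ) ≤ 2 ^ m := one_le_pow₀ one_le_two
    calc ‖z‖ ^ (m + N) / (m + N).factorial ≤ 2 ^ m * (‖z‖ ^ (m + N) / (m + N).factorial) :=
          le_mul_of_one_le_left (by positivity) this
      _ = _ := by
          rw [mul_pow, pow_add 2 m N, one_div, inv_pow]
          field_simp
  · gcongr
    refine sub_le_self _ (Finset.sum_nonneg fun m _ => by positivity)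

theorem contDiff_expTail (N : ℕ) : ContDiff ℝ ∞ fun t : ℝ => expTail N (Complex.I * t) := by
  have h : ContDiff ℝ ∞ fun t : ℝ => Complex.I * (t : ℂ) :=
    contDiff_const.mul Complex.ofRealCLM.contDiff
  exact h.cexp.sub (ContDiff.sum fun m _ => (h.pow m).div_const _)

theorem iteratedDeriv_expTail (i N : ℕ) :
    iteratedDeriv i (fun t : ℝ => expTail N (Complex.I * t)) =
      fun t : ℝ => Complex.I ^ i * expTail (N - i) (Complex.I * t) := by
  induction i with
  | zero => simp
  | succ i ih =>
    ext t
    rw [iteratedDeriv_succ, ih]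
    have h1 : HasDerivAt (fun t : ℝ => Complex.I * (t : ℂ)) (Complex.I * 1) t :=
      ((hasDerivAt_id t).ofReal_comp).const_mul _
    have h2 := ((hasDerivAt_expTail (N - i) (Complex.I * t)).comp t h1).const_mul (Complex.I ^ i)
    refine h2.deriv.trans ?_
    rw [Nat.sub_sub, pow_succ]
    ring

variable {V : Type*} [NormedAddCommGroup V] [NormedSpace ℝ V]

theorem norm_iteratedFDeriv_expTail_comp_le (L : V →L[ℝ] ℝ) {i n : ℕ} (hi : i ≤ n) (N : ℕ) (x : V) :
    ‖iteratedFDeriv ℝ i (fun x => expTail N (Complex.I * L x)) x‖ ≤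
      (1 / 2) ^ N * (2 * (1 + ‖L‖)) ^ n * Real.exp (2 * ‖L‖ * ‖x‖) := by
  have h1 := L.iteratedFDeriv_comp_right (contDiff_expTail N) x
    (i := i) (mod_cast le_top)
  have h2 : iteratedFDeriv ℝ i (fun x => expTail N (Complex.I * L x)) x =
      (iteratedFDeriv ℝ i (fun t : ℝ => expTail N (Complex.I * t)) (L x)).compContinuousLinearMap
        fun _ => L := h1
  rw [h2]
  refine (ContinuousMultilinearMap.norm_compContinuousLinearMap_le _ _).trans ?_
  rw [norm_iteratedFDeriv_eq_norm_iteratedDeriv, iteratedDeriv_expTail]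
  simp only [norm_mul, norm_pow, Complex.norm_I, one_pow, one_mul, Finset.prod_const,
    Finset.card_univ, Fintype.card_fin]
  have h3 : ‖L x‖ ≤ ‖L‖ * ‖x‖ := L.le_opNorm x
  -- Each derivative lowers the index of the remainder by one and costs a factor 2; when i ≥ N the
  -- left side is 1.
  have h4 : (1 / 2 : ℝ) ^ (N - i) ≤ (1 / 2) ^ N * 2 ^ n := by
    rcases le_total i N with hN | hN
    · calc (1 / 2 : ℝ) ^ (N - i) = (1 / 2) ^ (N - i) * ((1 / 2) ^ i * 2 ^ i) := by
            rw [← mul_pow]; norm_num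
        _ = (1 / 2) ^ N * 2 ^ i := by rw [← mul_assoc, ← pow_add, Nat.sub_add_cancel hN]
        _ ≤ _ := by gcongr; norm_num
    · rw [Nat.sub_eq_zero_of_le hN, pow_zero]
      calc (1 : ℝ) = (1 / 2) ^ N * 2 ^ N := by rw [← mul_pow]; norm_num
        _ ≤ _ := by gcongr; norm_num; omega
  have h5 : ‖L‖ ^ i ≤ (1 + ‖L‖) ^ n :=
    (pow_le_pow_left₀ (norm_nonneg _) (by linarith) i).trans
      (pow_le_pow_right₀ (by linarith [norm_nonneg L]) hi)
  calc _ ≤ (1 / 2) ^ (N - i) * Real.exp (2 * ‖Complex.I * (L x : ℂ)‖) * ‖L‖ ^ i := by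
        gcongr
        exact norm_expTail_le _ _
    _ ≤ ((1 / 2) ^ N * 2 ^ n) * Real.exp (2 * ‖L‖ * ‖x‖) * (1 + ‖L‖) ^ n := by
        refine mul_le_mul (mul_le_mul h4 (Real.exp_le_exp.2 ?_) (Real.exp_nonneg _)
          (by positivity)) h5 (by positivity) (by positivity)
        rw [norm_mul, Complex.norm_I, one_mul, Complex.norm_real]
        linarith
    _ = _ := by
        rw [mul_pow]
        ring

theorem mem_of_eq_exp_mul {M : Submodule ℂ 𝓢(V, ℂ)} (hM : IsClosed (M : Set 𝓢(V, ℂ)))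
    {f : 𝓢(V, ℂ)}
    (hf : ∀ (a : ℝ) (k n : ℕ), ∃ C, ∀ x,
      Real.exp (a * ‖x‖) * (‖x‖ ^ k * ‖iteratedFDeriv ℝ n f x‖) ≤ C)
    (L : V →L[ℝ] ℝ)
    (hL : ∀ m : ℕ, smulLeftCLM ℂ (fun x => ((L x : ℝ) : ℂ) ^ m) f ∈ M)
    {g : 𝓢(V, ℂ)} (hg : ∀ x, g x = Complex.exp (Complex.I * L x) * f x) : g ∈ M := by
  have hgr (m : ℕ) : (fun x => ((L x : ℝ) : ℂ) ^ m).HasTemperateGrowth :=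
    (Complex.ofRealCLM ∘L L).hasTemperateGrowth.fun_pow m
  refine hM.mem_of_tendsto (b := Filter.atTop) (f := fun N : ℕ => ∑ m ∈ Finset.range N,
      (Complex.I ^ m / m.factorial) • smulLeftCLM ℂ (fun x => ((L x : ℝ) : ℂ) ^ m) f)
    (((schwartz_withSeminorms ℂ V ℂ).tendsto_nhds _ _).2 fun ⟨k, n⟩ ε hε => ?_)
    (Filter.Eventually.of_forall fun N => M.sum_mem fun m _ => M.smul_mem _ (hL m))
  obtain ⟨C, hC, hD⟩ := exists_uniform_bound (fun j => hf (2 * ‖L‖) k j) n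
  have hb (N : ℕ) : SchwartzMap.seminorm ℂ k n (∑ m ∈ Finset.range N,
      (Complex.I ^ m / m.factorial) • smulLeftCLM ℂ (fun x => ((L x : ℝ) : ℂ) ^ m) f - g) ≤
      (1 / 2) ^ N * ((2 * (1 + ‖L‖)) ^ n * (2 ^ n * C)) := by
    rw [map_sub_rev]
    refine seminorm_le_bound ℂ k n _ (by positivity) fun x => ?_
    have he : ⇑(g - ∑ m ∈ Finset.range N,
        (Complex.I ^ m / m.factorial) • smulLeftCLM ℂ (fun x => ((L x : ℝ) : ℂ) ^ m) f) =
        fun x => expTail N (Complex.I * L x) * f x := by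
      ext x
      simp only [sub_apply, sum_apply, smul_apply, hg, expTail, sub_mul, Finset.sum_mul,
        smulLeftCLM_apply_apply (hgr _), smul_eq_mul]
      congr 1
      refine Finset.sum_congr rfl fun m _ => ?_
      ring
    rw [he, ← mul_assoc]
    exact norm_pow_mul_iteratedFDeriv_mul_le
      (((contDiff_expTail N).comp L.contDiff).of_le (mod_cast le_top)) (f.smooth n)
      (by positivity)
      (fun i hi => norm_iteratedFDeriv_expTail_comp_le L hi N x) fun j hj => hD j hj x
  have ht : Filter.Tendsto (fun N : ℕ => (1 / 2 : ℝ) ^ N * ((2 * (1 + ‖L‖)) ^ n * (2 ^ n * C)))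
      Filter.atTop (nhds 0) := by
    simpa using (tendsto_pow_atTop_nhds_zero_of_lt_one (by norm_num) (by norm_num : (1 / 2 : ℝ) < 1)
      ).mul_const ((2 * (1 + ‖L‖)) ^ n * (2 ^ n * C))
  filter_upwards [ht.eventually (gt_mem_nhds hε)] with N hN
  exact (hb N).trans_lt hN

end Exponential

/-! ### From characters to arbitrary multipliers -/

section Characters

variable {V : Type*} [NormedAddCommGroup V] [InnerProductSpace ℝ V] [FiniteDimensional ℝ V]
  [MeasurableSpace V] [BorelSpace V]

theorem fourier_compSubConstCLM_apply (γ : 𝓢(V, ℂ)) (y v : V) :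
    𝓕 (γ.compSubConstCLM ℂ y) v =
      Complex.exp (Complex.I * (-(2 * Real.pi) * inner ℝ y v : ℝ)) * 𝓕 γ v := by
  have h := congrFun (VectorFourier.fourierIntegral_comp_add_right Real.fourierChar volume
    (innerₗ V) γ (-y)) v
  have h1 : 𝓕 (γ.compSubConstCLM ℂ y) v =
      VectorFourier.fourierIntegral Real.fourierChar volume (innerₗ V)
        (γ ∘ fun v => v + -y) v := by
    rw [fourier_coe, Real.fourier_eq]
    simp [VectorFourier.fourierIntegral, sub_eq_add_neg]
  rw [h1, h, Circle.smul_def, Real.fourierChar_apply, fourier_coe, Real.fourier_eq]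
  simp only [innerₗ_apply_apply, inner_neg_left, smul_eq_mul]
  congr 2
  push_cast
  ring

theorem mul_mem_of_exp_mul_mem {M : Submodule ℂ 𝓢(V, ℂ)} (hM : IsClosed (M : Set 𝓢(V, ℂ)))
    {φ : 𝓢(V, ℂ)}
    (h : ∀ (y : V) (g : 𝓢(V, ℂ)),
      (∀ x, g x = Complex.exp (Complex.I * (-(2 * Real.pi) * inner ℝ y x : ℝ)) * φ x) → g ∈ M)
    (ψ : 𝓢(V, ℂ)) : pairing (ContinuousLinearMap.mul ℂ ℂ) ψ φ ∈ M := by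
  let F := FourierTransform.fourierCLM ℂ 𝓢(V, ℂ)
  -- Translation becomes modulation under 𝓕, so the translates of 𝓕⁻φ lie in the preimage of `M`,
  -- which is again closed.
  have h1 (y : V) : (𝓕⁻ φ).compSubConstCLM ℂ y ∈ M.comap (F : 𝓢(V, ℂ) →ₗ[ℂ] 𝓢(V, ℂ)) := by
    refine h y _ fun x => ?_
    have := fourier_compSubConstCLM_apply (𝓕⁻ φ) y x
    rwa [FourierTransform.fourier_fourierInv_eq] at this
  have h2 := convolution_mem_of_compSubConstCLM_mem (hM.preimage F.continuous) h1 (𝓕⁻ ψ)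
  have h3 : F (convolution (ContinuousLinearMap.mul ℂ ℂ) (𝓕⁻ ψ) (𝓕⁻ φ)) =
      pairing (ContinuousLinearMap.mul ℂ ℂ) ψ φ := by
    refine (fourier_convolution _ _ _).trans ?_
    rw [FourierTransform.fourier_fourierInv_eq, FourierTransform.fourier_fourierInv_eq]
  rw [← h3]
  exact h2

theorem eq_top_of_exp_mul_mem {M : Submodule ℂ 𝓢(V, ℂ)} (hM : IsClosed (M : Set 𝓢(V, ℂ)))
    {φ : 𝓢(V, ℂ)} (hφ : ∀ x, φ x ≠ 0)
    (h : ∀ (y : V) (g : 𝓢(V, ℂ)),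
      (∀ x, g x = Complex.exp (Complex.I * (-(2 * Real.pi) * inner ℝ y x : ℝ)) * φ x) → g ∈ M) :
    M = ⊤ := by
  refine eq_top_of_hasCompactSupport_mem hM fun f hf => ?_
  have h1 : HasCompactSupport fun x => f x * (φ x)⁻¹ := hf.mul_right
  have h2 : ContDiff ℝ ∞ fun x => f x * (φ x)⁻¹ := (f.smooth ⊤).mul ((φ.smooth ⊤).inv hφ)
  convert mul_mem_of_exp_mul_mem hM h (h1.toSchwartzMap h2)
  ext x
  simp [hφ x]

end Characters

end WeakMoment

namespace WeakMoment

open scoped ContDiff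
open SchwartzMap

/-! ### Exponential decay of the Gaussian kernel -/

section Gaussian

variable {d : ℕ} {A : Matrix (Fin d) (Fin d) ℝ}

/-- Unlike `gaussian_decay`, this keeps the Gaussian factor explicit so that an exponential weight
can be played against it. -/
theorem exists_norm_iteratedFDeriv_gaussianKernel_le (hA : A.PosDef) (c : ℝ) (n : ℕ) :
    ∃ (m K : ℝ) (l : ℕ), 0 < m ∧ 0 ≤ K ∧ ∀ x, ‖iteratedFDeriv ℝ n (gaussianKernel A hA c) x‖ ≤
      K * (1 + ‖x‖) ^ l * Real.exp (-(m * ‖x‖ ^ 2)) := by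
  obtain ⟨m, hm, hq⟩ := exists_le_quadForm hA
  have hg : (fun x => -(1 / 2) * quadForm A x).HasTemperateGrowth :=
    (Function.HasTemperateGrowth.const _).fun_mul (quadForm_hasTemperateGrowth A)
  obtain ⟨l, K, hK, hder⟩ := hg.norm_iteratedFDeriv_le_uniform n
  have he : ContDiff ℝ n (fun t : ℝ => c * Real.exp t) := contDiff_const.mul Real.contDiff_exp
  have hg' : ContDiff ℝ n (fun x => -(1 / 2) * quadForm A x) :=
    hg.1.of_le (by exact_mod_cast le_top)
  refine ⟨m / 2, n.factorial * |c| * (1 + K) ^ n, l * n, half_pos hm, by positivity, fun x => ?_⟩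
  have h0 : ‖iteratedFDeriv ℝ n (gaussianKernel A hA c) x‖ =
      ‖iteratedFDeriv ℝ n ((fun t : ℝ => c * Real.exp t) ∘
        (fun x => -(1 / 2) * quadForm A x)) x‖ :=
    Complex.ofRealLI.norm_iteratedFDeriv_comp_left (he.comp hg').contDiffAt le_rfl
  have h1 : ‖iteratedFDeriv ℝ n ((fun t : ℝ => c * Real.exp t) ∘
        (fun x => -(1 / 2) * quadForm A x)) x‖ ≤
      n.factorial * (|c| * Real.exp (-(1 / 2) * quadForm A x)) *
        ((1 + K) * (1 + ‖x‖) ^ l) ^ n := by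
    refine norm_iteratedFDeriv_comp_le he hg' le_rfl x (fun i _ => ?_) fun i hi hin => ?_
    · have : iteratedDeriv i (fun t : ℝ => c * Real.exp t) = fun t => c * Real.exp t := by
        ext t
        rw [iteratedDeriv_const_mul_field, iteratedDeriv_eq_iterate, Real.iter_deriv_exp]
      rw [norm_iteratedFDeriv_eq_norm_iteratedDeriv, this]
      simp
    · have h2 : 1 ≤ (1 + ‖x‖) ^ l := one_le_pow₀ (by linarith [norm_nonneg x])
      have h3 : 1 ≤ (1 + K) * (1 + ‖x‖) ^ l := one_le_mul_of_one_le_of_one_le (by linarith) h2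
      calc _ ≤ K * (1 + ‖x‖) ^ l := hder i hin x
        _ ≤ (1 + K) * (1 + ‖x‖) ^ l := by gcongr; linarith
        _ ≤ _ := le_self_pow₀ h3 (by omega)
  have h4 : Real.exp (-(1 / 2) * quadForm A x) ≤ Real.exp (-(m / 2 * ‖x‖ ^ 2)) := by
    apply Real.exp_le_exp.2
    linarith [hq x]
  rw [h0]
  calc _ ≤ n.factorial * (|c| * Real.exp (-(m / 2 * ‖x‖ ^ 2))) *
        ((1 + K) * (1 + ‖x‖) ^ l) ^ n := by
        refine h1.trans ?_
        gcongr
    _ = _ := by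
        rw [mul_pow, ← pow_mul]
        ring

theorem exists_exp_mul_pow_mul_exp_le (a : ℝ) (m : ℕ) {b : ℝ} (hb : 0 < b) :
    ∃ C : ℝ, ∀ r : ℝ, 0 ≤ r →
      Real.exp (a * r) * ((1 + r) ^ m * Real.exp (-(b * r ^ 2))) ≤ C := by
  obtain ⟨C, hC⟩ := exists_pow_mul_exp_le m (half_pos hb)
  refine ⟨Real.exp (a ^ 2 / (2 * b)) * C, fun r hr => ?_⟩
  -- Completing the square: half of the Gaussian absorbs exp(ar), the other half is left for the
  -- polynomial.
  have h1 : a * r - b * r ^ 2 ≤ a ^ 2 / (2 * b) - b / 2 * r ^ 2 := by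
    have h2 : a ^ 2 / (2 * b) - b / 2 * r ^ 2 - (a * r - b * r ^ 2) =
        b / 2 * (r - a / b) ^ 2 := by
      field_simp
      ring
    have h3 : 0 ≤ b / 2 * (r - a / b) ^ 2 := by positivity
    linarith
  calc _ = (1 + r) ^ m * Real.exp (a * r - b * r ^ 2) := by
        rw [sub_eq_add_neg, Real.exp_add]
        ring
    _ ≤ (1 + r) ^ m * Real.exp (a ^ 2 / (2 * b) - b / 2 * r ^ 2) := by gcongr
    _ = Real.exp (a ^ 2 / (2 * b)) * ((1 + r) ^ m * Real.exp (-(b / 2 * r ^ 2))) := by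
        rw [sub_eq_add_neg, Real.exp_add]
        ring
    _ ≤ _ := by
        gcongr
        exact hC r hr

theorem gaussianKernel_exp_decay (hA : A.PosDef) (c a : ℝ) (k n : ℕ) :
    ∃ C, ∀ x, Real.exp (a * ‖x‖) *
      (‖x‖ ^ k * ‖iteratedFDeriv ℝ n (gaussianKernel A hA c) x‖) ≤ C := by
  obtain ⟨m, K, l, hm, hK, h⟩ := exists_norm_iteratedFDeriv_gaussianKernel_le hA c n
  obtain ⟨C, hC⟩ := exists_exp_mul_pow_mul_exp_le a (k + l) hm
  refine ⟨K * C, fun x => ?_⟩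
  calc _ ≤ Real.exp (a * ‖x‖) *
        ((1 + ‖x‖) ^ k * (K * (1 + ‖x‖) ^ l * Real.exp (-(m * ‖x‖ ^ 2)))) := by
        gcongr
        · linarith
        · exact h x
    _ = K * (Real.exp (a * ‖x‖) * ((1 + ‖x‖) ^ (k + l) * Real.exp (-(m * ‖x‖ ^ 2)))) := by
        rw [pow_add]
        ring
    _ ≤ _ := by
        gcongr
        exact hC _ (norm_nonneg x)

end Gaussian

/-! ### The span of the monomial multiples, and totality -/

section Span

variable {d : ℕ}

theorem smulLeftCLM_coord_mem_span (φ : 𝓢(EuclideanSpace ℝ (Fin d), ℂ)) (i : Fin d)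
    {f : 𝓢(EuclideanSpace ℝ (Fin d), ℂ)}
    (hf : f ∈ Submodule.span ℂ (Set.range fun α => monomialMul α φ)) :
    smulLeftCLM ℂ (fun x => ((x i : ℝ) : ℂ)) f ∈
      Submodule.span ℂ (Set.range fun α => monomialMul α φ) := by
  have hi : (fun x : EuclideanSpace ℝ (Fin d) => ((x i : ℝ) : ℂ)).HasTemperateGrowth :=
    (Complex.ofRealCLM ∘L EuclideanSpace.proj (𝕜 := ℝ) i).hasTemperateGrowth
  induction hf using Submodule.span_induction with
  | mem f hf =>
    obtain ⟨α, rfl⟩ := hf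
    refine Submodule.subset_span ⟨α + Pi.single i 1, ?_⟩
    ext x
    have : ∏ j, x j ^ (Pi.single i 1 : Fin d → ℕ) j = x i := by
      rw [Finset.prod_eq_single i (fun j _ hj => by simp [hj]) (by simp)]
      simp
    simp only [monomialMul_apply, smulLeftCLM_apply_apply hi, Pi.add_apply, pow_add,
      Finset.prod_mul_distrib, this, smul_eq_mul]
    push_cast
    ring
  | zero => simp
  | add f g _ _ hf hg => simpa using Submodule.add_mem _ hf hg
  | smul a f _ hf => simpa using Submodule.smul_mem _ a hf

/-- Induction on the power: L is a combination of coordinates, and multiplying by a coordinate keeps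
the span stable. -/
theorem smulLeftCLM_pow_mem_span (φ : 𝓢(EuclideanSpace ℝ (Fin d), ℂ))
    (L : EuclideanSpace ℝ (Fin d) →L[ℝ] ℝ) (m : ℕ) :
    smulLeftCLM ℂ (fun x => ((L x : ℝ) : ℂ) ^ m) φ ∈
      Submodule.span ℂ (Set.range fun α => monomialMul α φ) := by
  have hL (m : ℕ) : (fun x => ((L x : ℝ) : ℂ) ^ m).HasTemperateGrowth :=
    (Complex.ofRealCLM ∘L L).hasTemperateGrowth.fun_pow m
  have hi (i : Fin d) :
      (fun x : EuclideanSpace ℝ (Fin d) => ((x i : ℝ) : ℂ)).HasTemperateGrowth :=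
    (Complex.ofRealCLM ∘L EuclideanSpace.proj (𝕜 := ℝ) i).hasTemperateGrowth
  induction m with
  | zero =>
    refine Submodule.subset_span ⟨0, ?_⟩
    ext x
    simp
  | succ m ih =>
    have h : smulLeftCLM ℂ (fun x => ((L x : ℝ) : ℂ) ^ (m + 1)) φ =
        ∑ i, ((L (EuclideanSpace.single i 1) : ℝ) : ℂ) • smulLeftCLM ℂ (fun x => ((x i : ℝ) : ℂ))
          (smulLeftCLM ℂ (fun x => ((L x : ℝ) : ℂ) ^ m) φ) := by
      ext x
      have hx : L x = ∑ i, L (EuclideanSpace.single i 1) * x i := by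
        conv_lhs => rw [← (EuclideanSpace.basisFun (Fin d) ℝ).sum_repr x]
        simp [mul_comm]
      simp only [sum_apply, smul_apply, smulLeftCLM_apply_apply (hL _),
        smulLeftCLM_apply_apply (hi _), smul_eq_mul, ← mul_assoc, ← Finset.sum_mul]
      rw [pow_succ', hx]
      push_cast
      ring
    rw [h]
    exact Submodule.sum_mem _ fun i _ =>
      Submodule.smul_mem _ _ (smulLeftCLM_coord_mem_span φ i ih)

theorem isTotal_monomialMul_gaussianKernel {A : Matrix (Fin d) (Fin d) ℝ} (hA : A.PosDef) {c : ℝ}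
    (hc : 0 < c) : IsTotal fun α : Fin d → ℕ => monomialMul α (gaussianKernel A hA c) := by
  refine Submodule.dense_iff_topologicalClosure_eq_top.2
    (eq_top_of_exp_mul_mem (φ := gaussianKernel A hA c)
      (Submodule.isClosed_topologicalClosure _) (fun x => ?_) fun y g hg => ?_)
  · rw [gaussianKernel_apply]
    exact_mod_cast (mul_pos hc (Real.exp_pos _)).ne'
  · refine mem_of_eq_exp_mul (Submodule.isClosed_topologicalClosure _)
      (gaussianKernel_exp_decay hA c) (-(2 * Real.pi) • innerSL ℝ y)
      (fun m => Submodule.le_topologicalClosure _ (smulLeftCLM_pow_mem_span _ _ m)) fun x => ?_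
    simpa using hg x

end Span

end WeakMoment

theorem mainTheorem4 (d : ℕ) (A : Matrix (Fin d) (Fin d) ℝ) (hA : A.PosDef) (c : ℝ) (hc : 0 < c) :
    WeakMoment.IsTotal (fun α : Fin d → ℕ =>
      WeakMoment.monomialMul α (WeakMoment.gaussianKernel A hA c)) ∧
    ∀ T₁ T₂ : 𝓢'(EuclideanSpace ℝ (Fin d), ℂ),
      (∀ α : Fin d → ℕ,
        WeakMoment.weakMoment T₁ (WeakMoment.gaussianKernel A hA c) α =
          WeakMoment.weakMoment T₂ (WeakMoment.gaussianKernel A hA c) α) →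
      T₁ = T₂ := by
  have h := WeakMoment.isTotal_monomialMul_gaussianKernel hA hc
  refine ⟨h, fun T₁ T₂ hT => ContinuousLinearMap.ext_on h ?_⟩
  rintro _ ⟨α, rfl⟩
  exact hT α
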